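/- Let $X$ be a standard Borel space and let $\mathcal R\subset X\times X$ be a discrete Borel equivalence relation, i.e. $\mathcal R$ is Borel and every class $[x]_{\mathcal R}$ is countable. Let $\pi:\mathcal H\to X$ be a bundle of hyperbolic spaces: $\mathcal H$ is a standard Borel space, $\pi$ is a Borel surjection, each fiber $\mathcal H_x=\pi^{-1}(x)$ carries a metric for which it is a geodesic Gromov hyperbolic space, and the resulting map $d$ on $\{(p,q)\in\mathcal H\times\mathcal H:\pi(p)=\pi(q)\}$ is Borel. Let $\mathcal R$ act on $\mathcal H$ by isometries: there are isometries $\alpha(x,y):\mathcal H_y\to\mathcal H_x$ for $(x,y)\in\mathcal R$ such that $\alpha(x,y)\alpha(y,z)=\alpha(x,z)$ and $\{(p,q)\in\mathcal H\times\mathcal H:(\pi(p),\pi(q))\in\mathcal R,\ \alpha(\pi(p),\pi(q))q=p\}$ is Borel. Let $\sigma:X\to\mathcal H$ be a Borel section, let $\sigma_x:[x]_{\mathcal R}\to\mathcal H_x$ be the map $\sigma_x(y)=\alpha(x,y)\sigma(y)$, and let $d_\sigma(x,y)=d(\sigma_z(x),\sigma_z(y))$ for $(x,y)\in\mathcal R$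 and any $z\in[x]_{\mathcal R}$ (this does not depend on $z$). Suppose that for every $x\in X$ every metric ball of $\mathcal H_x$ contains only finitely many points of the orbit $\sigma_x([x]_{\mathcal R})$ ($\sigma$ is metrically proper), and that for some real $r>0$ and every $x\in X$ the open $r$-neighborhood of the orbit $\sigma_x([x]_{\mathcal R})$ is all of $\mathcal H_x$ ($\sigma$ is $r$-cobounded). Then $$\mathcal G=\{(x,y)\in\mathcal R:\ d_\sigma(x,y)\le 3r\}$$ is a hyperbolic graphing of $\mathcal R$: $\mathcal G$ is Borel and symmetric, $\mathcal R$ is the smallest equivalence relation containing $\mathcal G$, and for every $x\in X$ the metric graph (edges of length $1$) with vertex set $[x]_{\mathcal R}$ and edges $\{y,z\}$, $y\neq z$, $(y,z)\in\mathcal G$, is Gromov hyperbolic. If moreover every map $\sigma_x$ is finite-to-one, so that $\sigma_x^{-1}(B)$ is finite for every metric ball $B\subset\mathcal H_x$, then $\mathcal G$ is locally finite: for every $x\in X$ there are only finitely many $y$ with $(x,y)\in\mathcal G$. -/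

import Mathlib

noncomputable section

namespace HypBundle

/-! ### Gromov hyperbolicity -/

/-- The Gromov product `(x|y)_z` with respect to a distance function `d`. -/
def gromovProduct {Y : Type*} (d : Y → Y → ℝ) (x y z : Y) : ℝ :=
  (d x z + d y z - d x y) / 2

/-- `d` is `δ`-hyperbolic for some real `δ`. -/
def GromovHyperbolic {Y : Type*} (d : Y → Y → ℝ) : Prop :=
  ∃ δ : ℝ, ∀ x y z w : Y,
    min (gromovProduct d x w z) (gromovProduct d w y z) - δ ≤ gromovProduct d x y z

/-- Any two points are joined by a geodesic. -/
def IsGeodesicSpace (Y : Type*) [MetricSpace Y] : Prop :=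
  ∀ a b : Y, ∃ γ : ℝ → Y, γ 0 = a ∧ γ (dist a b) = b ∧
    ∀ s ∈ Set.Icc 0 (dist a b), ∀ t ∈ Set.Icc 0 (dist a b), dist (γ s) (γ t) = |s - t|

/-! ### The metric graph of a connected simple graph -/

/-- A point of the metric graph in which every edge of `G` is an interval of length `1`: either
the point at distance `pos` from `src` on the edge from `src` to `tgt`, or a vertex
(`src = tgt`, `pos = 0`). A point may be presented in several ways; two presentations of the same
point are at distance `0` for `MetricGraphPoint.dist`. -/
structure MetricGraphPoint {V : Type*} (G : SimpleGraph V) where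
  src : V
  tgt : V
  pos : ℝ
  pos_mem : pos ∈ Set.Icc (0 : ℝ) 1
  edge : G.Adj src tgt ∨ (src = tgt ∧ pos = 0)

open Classical in
/-- The length of a shortest path in the metric graph (meaningful for connected `G`). Two points
of one edge are joined along that edge; otherwise a shortest path leaves each of the two edges
through one of its end points. -/
def MetricGraphPoint.dist {V : Type*} {G : SimpleGraph V} (p q : MetricGraphPoint G) : ℝ :=
  if p.src = q.src ∧ p.tgt = q.tgt then |p.pos - q.pos|
  else if p.src = q.tgt ∧ p.tgt = q.src then |p.pos - (1 - q.pos)|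
  else
    min
      (min (p.pos + G.dist p.src q.src + q.pos)
        (p.pos + G.dist p.src q.tgt + (1 - q.pos)))
      (min ((1 - p.pos) + G.dist p.tgt q.src + q.pos)
        ((1 - p.pos) + G.dist p.tgt q.tgt + (1 - q.pos)))

/-- The vertex `v` as a point of the metric graph. -/
def MetricGraphPoint.vertex {V : Type*} (G : SimpleGraph V) (v : V) : MetricGraphPoint G :=
  ⟨v, v, 0, by simp, Or.inr ⟨rfl, rfl⟩⟩

/-- Between vertices the distance in the metric graph is the combinatorial one. -/
theorem MetricGraphPoint.dist_vertex {V : Type*} (G : SimpleGraph V) (v w : V) :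
    (MetricGraphPoint.vertex G v).dist (MetricGraphPoint.vertex G w) = G.dist v w := by
  by_cases h : v = w
  · subst h; simp [MetricGraphPoint.dist, MetricGraphPoint.vertex]
  · simp only [MetricGraphPoint.dist, MetricGraphPoint.vertex, h, and_self, if_false]
    rw [min_eq_left, min_eq_left] <;> simp

/-! ### Equivalence relations and graphings -/

section Relations

variable {X : Type*}

/-- The equivalence class `[x]_R`. -/
abbrev EqClass (R : Setoid X) (x : X) : Type _ := {y : X // R x y}

/-- `R` is a discrete Borel equivalence relation: it is a Borel subset of `X × X` and its classes
are countable. -/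
structure IsDiscreteBorel [MeasurableSpace X] (R : Setoid X) : Prop where
  measurableSet : MeasurableSet {p : X × X | R p.1 p.2}
  countable_class : ∀ x : X, {y : X | R x y}.Countable

/-- `𝒢` is a graphing of `R`: a symmetric Borel subset of `R` such that `R` is the smallest
equivalence relation containing it. -/
structure IsGraphing [MeasurableSpace X] (R : Setoid X) (𝒢 : Set (X × X)) : Prop where
  measurableSet : MeasurableSet 𝒢
  symm : ∀ x y : X, (x, y) ∈ 𝒢 → (y, x) ∈ 𝒢
  generates : IsLeast {S : Setoid X | ∀ x y : X, (x, y) ∈ 𝒢 → S x y} R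

/-- The graph `𝒢_x`: its vertex set is `[x]_R` and its edges are the pairs `{y, z}`, `y ≠ z`,
with `(y, z) ∈ 𝒢`. -/
def graphAt (R : Setoid X) (𝒢 : Set (X × X)) (x : X) : SimpleGraph (EqClass R x) :=
  SimpleGraph.fromRel fun y z => (y.1, z.1) ∈ 𝒢

/-- A graphing is hyperbolic if each metric graph `𝒢_x` is Gromov hyperbolic. -/
structure IsHyperbolicGraphing [MeasurableSpace X] (R : Setoid X) (𝒢 : Set (X × X)) : Prop where
  isGraphing : IsGraphing R 𝒢
  hyperbolic : ∀ x : X, GromovHyperbolic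
    (MetricGraphPoint.dist : MetricGraphPoint (graphAt R 𝒢 x) → _ → ℝ)

/-- Every vertex has finitely many neighbours. -/
def IsLocallyFinite (𝒢 : Set (X × X)) : Prop :=
  ∀ x : X, {y : X | (x, y) ∈ 𝒢}.Finite

end Relations

/-! ### Metric bundles, actions and sections -/

/-- A metric bundle over `X` with total space `H` (standard Borel in the theorem): a Borel
surjection `H → X` with a metric on every fiber that is Borel as a function on the fiber
product. -/
structure MetricBundle (X H : Type*) [MeasurableSpace X] [MeasurableSpace H] where
  proj : H → X
  measurable_proj : Measurable proj
  surjective_proj : Function.Surjective proj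
  metric : ∀ x : X, MetricSpace {p : H // proj p = x}
  measurable_dist : Measurable fun p : {p : H × H // proj p.1 = proj p.2} =>
    (metric (proj p.1.1)).dist ⟨p.1.1, rfl⟩ ⟨p.1.2, p.2.symm⟩

variable {X H : Type*} [MeasurableSpace X] [MeasurableSpace H]

/-- The fiber over `x`. -/
def MetricBundle.Fiber (B : MetricBundle X H) (x : X) : Type _ := {p : H // B.proj p = x}

instance (B : MetricBundle X H) (x : X) : MetricSpace (B.Fiber x) := B.metric x

/-- Each fiber is a geodesic Gromov hyperbolic space. -/
def MetricBundle.IsHyperbolic (B : MetricBundle X H) : Prop :=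
  ∀ x : X, IsGeodesicSpace (B.Fiber x) ∧
    GromovHyperbolic (dist : B.Fiber x → B.Fiber x → ℝ)

/-- A Borel section of the bundle. -/
structure BorelSection (B : MetricBundle X H) where
  toFun : X → H
  measurable_toFun : Measurable toFun
  proj_toFun : ∀ x : X, B.proj (toFun x) = x

/-- The value `σ(x)` as a point of the fiber over `x`. -/
def BorelSection.val {B : MetricBundle X H} (σ : BorelSection B) (x : X) : B.Fiber x :=
  ⟨σ.toFun x, σ.proj_toFun x⟩

/-- An action of `R` on the bundle by isometries `α(x,y) : H_y → H_x`, `(x,y) ∈ R`. -/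
structure IsometricAction (R : Setoid X) (B : MetricBundle X H) where
  map : ∀ {x y : X}, R x y → (B.Fiber y ≃ᵢ B.Fiber x)
  cocycle : ∀ {x y z : X} (hxy : R x y) (hyz : R y z) (p : B.Fiber z),
    map hxy (map hyz p) = map (R.trans hxy hyz) p
  borel : MeasurableSet {pq : H × H | ∃ h : R (B.proj pq.1) (B.proj pq.2),
    map h ⟨pq.2, rfl⟩ = (⟨pq.1, rfl⟩ : B.Fiber (B.proj pq.1))}

namespace IsometricAction

variable {R : Setoid X} {B : MetricBundle X H} (α : IsometricAction R B) (σ : BorelSection B)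

/-- The map `σ_x : [x]_R → H_x`, `σ_x(y) = α(x,y) σ(y)`; its range is the orbit of `x`. -/
def orbitMap (x : X) (y : EqClass R x) : B.Fiber x := α.map y.2 (σ.val y.1)

/-- Every metric ball of `H_x` contains only finitely many points of the orbit of `x`. -/
def MetricallyProper : Prop :=
  ∀ (x : X) (c : B.Fiber x) (s : ℝ), (Set.range (α.orbitMap σ x) ∩ Metric.ball c s).Finite

/-- Every point of an orbit is attained by only finitely many members of the class. -/
def FiniteToOne : Prop :=
  ∀ (x : X) (p : B.Fiber x), {y : EqClass R x | α.orbitMap σ x y = p}.Finite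

/-- The open `r`-neighbourhood of the orbit of `x` is all of `H_x`. -/
def Cobounded (r : ℝ) : Prop :=
  ∀ (x : X) (p : B.Fiber x), ∃ y : EqClass R x, dist p (α.orbitMap σ x y) < r

/-- `d_σ(x,y) = d(σ_z(x), σ_z(y))`, computed with `z = x`. -/
def dSigma {x y : X} (h : R x y) : ℝ :=
  dist (α.orbitMap σ x ⟨x, R.refl x⟩) (α.orbitMap σ x ⟨y, h⟩)

/-- The value of `d_σ` does not depend on the choice of `z`. -/
theorem dSigma_eq {x y z : X} (h : R x y) (hx : R z x) (hy : R z y) :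
    α.dSigma σ h = dist (α.orbitMap σ z ⟨x, hx⟩) (α.orbitMap σ z ⟨y, hy⟩) := by
  unfold dSigma orbitMap
  rw [← (α.map hx).dist_eq, α.cocycle, α.cocycle]

/-- The relation `{(x,y) ∈ R : d_σ(x,y) ≤ s}`. -/
def proximityGraph (s : ℝ) : Set (X × X) :=
  {p | ∃ h : R p.1 p.2, α.dSigma σ h ≤ s}

end IsometricAction

end HypBundle

end

namespace HypBundle

/-! ### Geodesics and quasi-geodesics in hyperbolic spaces -/

section Hyperbolic

variable {Y : Type*} [MetricSpace Y]

/-! Write `f` for an orbit map into one fiber. Walk along a geodesic of the fiber in steps of length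
`r` and pick an orbit point within `r` of each stop: consecutive picks are within `3 * r`, so the
proximity graph is connected (hence generates the relation) and graph distance is at most `1 / r`
times fiber distance plus `2`. Graph geodesics therefore map to discrete quasi-geodesics.

By stability of quasi-geodesics (`exists_forall_dist_quasiGeodesic_le`), a bounded Gromov product at
`f v` forces a bounded one at `v` in the graph (`exists_bound_gromovProduct_graph`). Choosing `v`
near the center of a geodesic triangle transfers the four-point inequality to the vertices, and
`gromovHyperbolic_metricGraph` passes to the metric graph. Borelness is Lusin–Souslin; local
finiteness comes from counting orbit points in a ball. -/

theorem gromovProduct_comm (x y z : Y) :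
    gromovProduct dist x y z = gromovProduct dist y x z := by
  unfold gromovProduct
  rw [dist_comm x y, add_comm (dist x z)]

theorem dist_sub_dist_le_gromovProduct (x y z : Y) :
    dist x z - dist x y ≤ gromovProduct dist x y z := by
  unfold gromovProduct
  linarith [dist_triangle x y z]

theorem gromovProduct_le_add_dist (x y z w : Y) :
    gromovProduct dist x y z ≤ gromovProduct dist x y w + dist w z := by
  unfold gromovProduct
  linarith [dist_triangle x w z, dist_triangle y w z]

/-- In a hyperbolic space the Gromov product of the ends of a chain with `2 ^ k` steps is bounded
below, up to an error of `k * δ`, by the Gromov products of consecutive points. -/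
theorem le_gromovProduct_of_chain {δ : ℝ}
    (hδ : ∀ x y z w : Y, min (gromovProduct dist x w z) (gromovProduct dist w y z) - δ ≤
      gromovProduct dist x y z)
    {p : Y} {u : ℕ → Y} {m : ℝ} {n : ℕ} (hu : ∀ l ≤ n, m ≤ dist (u l) p)
    (hs : ∀ l < n, m ≤ gromovProduct dist (u l) (u (l + 1)) p) (k : ℕ) :
    ∀ i j : ℕ, i ≤ j → j ≤ n → j ≤ i + 2 ^ k →
      m - k * δ ≤ gromovProduct dist (u i) (u j) p := by
  induction k with
  | zero =>
    intro i j hij hj hk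
    have hk' : j = i ∨ j = i + 1 := by simp at hk; omega
    rcases hk' with rfl | rfl
    · simpa [gromovProduct] using hu j hj
    · simpa using hs i (by omega)
  | succ k ih =>
    intro i j hij hj hk
    have h2 : 2 ^ (k + 1) = 2 ^ k + 2 ^ k := by ring
    -- Split the chain in two at `i + 2 ^ k`, clipped to `j`; joining the halves costs one `δ`.
    have a := ih i (min j (i + 2 ^ k)) (by simp [hij]) (by omega) (by omega)
    have b := ih (min j (i + 2 ^ k)) j (by omega) (by omega) (by omega)
    have c := hδ (u i) (u j) p (u (min j (i + 2 ^ k)))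
    have d := le_min a b
    push_cast
    linarith

/-- A quantity that is at most logarithmic in itself is bounded. -/
theorem exists_bound_of_le_log (a b c δ : ℝ) (ha : 0 ≤ a) (hδ : 0 < δ) :
    ∃ C : ℝ, ∀ D : ℝ, (∀ k : ℕ, a * D + b ≤ 2 ^ k → D ≤ c + δ * k) → D ≤ C := by
  have h1 : Filter.Tendsto (fun k : ℕ => (k : ℝ) ^ 1 / (2 : ℝ) ^ k) Filter.atTop (nhds 0) :=
    tendsto_pow_const_div_const_pow_of_one_lt 1 (by norm_num)
  have h2 : Filter.Tendsto (fun k : ℕ => 1 / (2 : ℝ) ^ k) Filter.atTop (nhds 0) := by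
    simpa using tendsto_pow_const_div_const_pow_of_one_lt 0 (r := (2 : ℝ)) (by norm_num)
  have h3 : Filter.Tendsto (fun k : ℕ => a * δ * ((k : ℝ) ^ 1 / (2 : ℝ) ^ k) +
      (a * (c + δ) + b) * (1 / (2 : ℝ) ^ k)) Filter.atTop (nhds 0) := by
    simpa using (h1.const_mul (a * δ)).add (h2.const_mul (a * (c + δ) + b))
  obtain ⟨K, hK⟩ := Filter.eventually_atTop.1 (h3.eventually_le_const zero_lt_one)
  have hK' : ∀ k ≥ K, a * (c + δ * (k + 1)) + b ≤ 2 ^ k := by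
    intro k hk
    have h := hK k hk
    have e : a * δ * ((k : ℝ) ^ 1 / (2 : ℝ) ^ k) + (a * (c + δ) + b) * (1 / (2 : ℝ) ^ k) =
        (a * (c + δ * (k + 1)) + b) / 2 ^ k := by
      field_simp
      ring
    rw [e, div_le_one (by positivity)] at h
    exact h
  refine ⟨c + δ * K, fun D hD => ?_⟩
  by_contra! hlt
  -- For the least such `k`, `D > c + δ * K` gives `k ≥ K`, so `hK'` makes `2 ^ k` large enough for
  -- the hypothesis on `D`, which then contradicts minimality.
  have hex : ∃ k : ℕ, D ≤ c + δ * (k + 1) := by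
    obtain ⟨k, hk⟩ := exists_nat_ge ((D - c) / δ)
    rw [div_le_iff₀ hδ] at hk
    exact ⟨k, by nlinarith⟩
  classical
  have hfind := Nat.find_spec hex
  set k := Nat.find hex with hkdef
  have hKk : K ≤ k := by
    by_contra! hkK
    have : ((k : ℝ) + 1) ≤ K := by exact_mod_cast hkK
    nlinarith
  have hDk := hD k ((by gcongr : a * D + b ≤ a * (c + δ * (k + 1)) + b).trans (hK' k hKk))
  rcases Nat.eq_zero_or_pos k with h | h
  · have : K = 0 := by omega
    rw [h] at hDk
    rw [this] at hlt
    linarith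
  · refine Nat.find_min hex (m := k - 1) (by omega) ?_
    rw [Nat.cast_sub h]
    simpa using hDk

/-- A geodesic in a hyperbolic space lies in a neighbourhood of bounded radius of any discrete
quasi-geodesic with the same end points. -/
theorem exists_forall_dist_quasiGeodesic_le (hY : GromovHyperbolic (dist : Y → Y → ℝ))
    (A a b : ℝ) (ha : 0 ≤ a) :
    ∃ C : ℝ, ∀ (n : ℕ) (u : ℕ → Y) (γ : ℝ → Y) (L : ℝ), 0 ≤ L →
      (∀ s ∈ Set.Icc 0 L, ∀ t ∈ Set.Icc 0 L, dist (γ s) (γ t) = |s - t|) →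
      γ 0 = u 0 → γ L = u n → (∀ l < n, dist (u l) (u (l + 1)) ≤ A) →
      (∀ i j, i ≤ j → j ≤ n → (j : ℝ) ≤ i + (a * dist (u i) (u j) + b)) →
      ∀ t ∈ Set.Icc 0 L, ∃ i ≤ n, dist (γ t) (u i) ≤ C := by
  obtain ⟨δ₀, hδ₀⟩ := hY
  obtain ⟨δ, hδ1, hδ⟩ : ∃ δ : ℝ, 1 ≤ δ ∧ ∀ x y z w : Y,
      min (gromovProduct dist x w z) (gromovProduct dist w y z) - δ ≤
        gromovProduct dist x y z :=
    ⟨max δ₀ 1, le_max_right _ _, fun x y z w => by linarith [hδ₀ x y z w, le_max_left δ₀ 1]⟩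
  -- The index gap below is at most `a * (6 * D + 6) + b`; `|A|` is lost to the step length and `2 *
  -- δ` to two final uses of hyperbolicity.
  obtain ⟨C, hC⟩ := exists_bound_of_le_log (a * 6) (a * 6 + b) (|A| + 2 * δ) δ
    (by positivity) (by linarith)
  refine ⟨C + 1, fun n u γ L hL hγ hγ0 hγL hstep hquasi => ?_⟩
  have hfin : (u '' Set.Iic n).Finite := (Set.finite_Iic n).image u
  have hne : (u '' Set.Iic n).Nonempty := ⟨u 0, 0, by simp, rfl⟩
  have hle : ∀ t, ∀ i ≤ n, Metric.infDist (γ t) (u '' Set.Iic n) ≤ dist (γ t) (u i) :=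
    fun t i hi => Metric.infDist_le_dist_of_mem ⟨i, hi, rfl⟩
  have hatt : ∀ t, ∃ i ≤ n, dist (γ t) (u i) = Metric.infDist (γ t) (u '' Set.Iic n) := by
    intro t
    obtain ⟨_, ⟨i, hi, rfl⟩, h⟩ := hfin.isCompact.exists_infDist_eq_dist hne (γ t)
    exact ⟨i, hi, h.symm⟩
  -- A point of the geodesic almost farthest from the chain; the slack `1` is the one in `C + 1`.
  obtain ⟨t, ht, hmax⟩ : ∃ t ∈ Set.Icc 0 L, ∀ s ∈ Set.Icc 0 L,
      Metric.infDist (γ s) (u '' Set.Iic n) ≤ Metric.infDist (γ t) (u '' Set.Iic n) + 1 := by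
    have hbdd : BddAbove ((fun s => Metric.infDist (γ s) (u '' Set.Iic n)) '' Set.Icc 0 L) := by
      refine ⟨L, ?_⟩
      rintro _ ⟨s, hs, rfl⟩
      refine (hle s 0 (by omega)).trans ?_
      rw [← hγ0, hγ s hs 0 ⟨le_rfl, hL⟩, sub_zero, abs_of_nonneg hs.1]
      exact hs.2
    obtain ⟨_, ⟨t, ht, rfl⟩, h⟩ := exists_lt_of_lt_csSup
      (⟨_, 0, ⟨le_rfl, hL⟩, rfl⟩ :
        ((fun s => Metric.infDist (γ s) (u '' Set.Iic n)) '' Set.Icc 0 L).Nonempty)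
      (sub_one_lt _)
    exact ⟨t, ht, fun s hs => by
      have := le_csSup hbdd ⟨s, hs, rfl⟩
      simp only at this h
      linarith⟩
  set D := Metric.infDist (γ t) (u '' Set.Iic n) with hD
  have hD0 : 0 ≤ D := Metric.infDist_nonneg
  suffices hDC : D ≤ C by
    intro s hs
    obtain ⟨i, hi, h⟩ := hatt s
    exact ⟨i, hi, by linarith [hmax s hs]⟩
  have hfar : ∀ l ≤ n, D ≤ dist (u l) (γ t) := fun l hl => by
    rw [dist_comm]; exact hle t l hl
  -- Go back `2 * D + 2` from `t`: a chain point lies within `D + 1`, so the product at `γ t` is at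
  -- least `(2 * D + 2) - (D + 1)`. If the geodesic ends sooner, its end is itself a chain point.
  obtain ⟨s₁, hs₁, hs₁t, i, hi, hd₁, hc₁, hg₁⟩ : ∃ s₁ ∈ Set.Icc 0 L, s₁ ≤ t ∧ ∃ i ≤ n,
      t - s₁ ≤ 2 * D + 2 ∧ dist (γ s₁) (u i) ≤ D + 1 ∧
        D ≤ gromovProduct dist (γ s₁) (u i) (γ t) := by
    rcases le_total t (2 * D + 2) with h | h
    · refine ⟨0, ⟨le_rfl, hL⟩, ht.1, 0, by omega, by linarith, ?_, ?_⟩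
      · rw [hγ0, dist_self]; linarith
      · rw [hγ0]; simpa [gromovProduct] using hfar 0 (by omega)
    · have hs : t - (2 * D + 2) ∈ Set.Icc 0 L := ⟨by linarith, by linarith [ht.2]⟩
      obtain ⟨i, hi, h'⟩ := hatt (t - (2 * D + 2))
      have h1 := hmax _ hs
      refine ⟨_, hs, by linarith, i, hi, by linarith, by linarith, ?_⟩
      have h2 := dist_sub_dist_le_gromovProduct (γ (t - (2 * D + 2))) (u i) (γ t)
      rw [hγ _ hs t ht, abs_of_nonpos (by linarith)] at h2
      linarith
  obtain ⟨s₂, hs₂, hs₂t, j, hj, hd₂, hc₂, hg₂⟩ : ∃ s₂ ∈ Set.Icc 0 L, t ≤ s₂ ∧ ∃ j ≤ n,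
      s₂ - t ≤ 2 * D + 2 ∧ dist (γ s₂) (u j) ≤ D + 1 ∧
        D ≤ gromovProduct dist (γ s₂) (u j) (γ t) := by
    rcases le_total L (t + (2 * D + 2)) with h | h
    · refine ⟨L, ⟨hL, le_rfl⟩, ht.2, n, le_rfl, by linarith, ?_, ?_⟩
      · rw [hγL, dist_self]; linarith
      · rw [hγL]; simpa [gromovProduct] using hfar n le_rfl
    · have hs : t + (2 * D + 2) ∈ Set.Icc 0 L := ⟨by linarith [ht.1], h⟩
      obtain ⟨i, hi, h'⟩ := hatt (t + (2 * D + 2))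
      have h1 := hmax _ hs
      refine ⟨_, hs, by linarith, i, hi, by linarith, by linarith, ?_⟩
      have h2 := dist_sub_dist_le_gromovProduct (γ (t + (2 * D + 2))) (u i) (γ t)
      rw [hγ _ hs t ht, abs_of_nonneg (by linarith)] at h2
      linarith
  have hs₁₂ : dist (γ s₁) (γ s₂) = s₂ - s₁ := by
    rw [hγ s₁ hs₁ s₂ hs₂, abs_of_nonpos (by linarith)]; ring
  have hzero : gromovProduct dist (γ s₁) (γ s₂) (γ t) = 0 := by
    unfold gromovProduct
    rw [hs₁₂, hγ s₁ hs₁ t ht, hγ s₂ hs₂ t ht, abs_of_nonpos (by linarith),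
      abs_of_nonneg (by linarith)]
    ring
  have hij : dist (u i) (u j) ≤ 6 * D + 6 := by
    have h1 := dist_triangle4 (u i) (γ s₁) (γ s₂) (u j)
    rw [dist_comm (u i) (γ s₁)] at h1
    linarith
  refine hC D fun k hk => ?_
  -- The chain between `u i` and `u j` stays at distance at least `D` from `γ t` and has at most `2
  -- ^ k` steps. The indices may come in either order.
  have hmid : D - |A| - k * δ ≤ gromovProduct dist (u i) (u j) (γ t) := by
    have chain := le_gromovProduct_of_chain hδ (p := γ t) (u := u)
      (m := D - |A|) (n := n) (fun l hl => by linarith [hfar l hl, abs_nonneg A])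
      (fun l hl => by
        have h1 := dist_sub_dist_le_gromovProduct (u l) (u (l + 1)) (γ t)
        linarith [hfar l hl.le, hstep l hl, le_abs_self A]) k
    have hlen : a * dist (u i) (u j) + b ≤ 2 ^ k := by
      have := mul_le_mul_of_nonneg_left hij ha
      linarith
    rcases le_total i j with h | h
    · refine chain i j h hj ?_
      have : (j : ℝ) ≤ i + 2 ^ k := by linarith [hquasi i j h hj]
      exact_mod_cast this
    · rw [gromovProduct_comm]
      refine chain j i h hi ?_
      rw [dist_comm] at hlen
      have : (i : ℝ) ≤ j + 2 ^ k := by linarith [hquasi j i h hi]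
      exact_mod_cast this
  -- The detour `γ s₁`, `u i`, `u j`, `γ s₂` has large consecutive products at `γ t`, yet its ends
  -- have product `0`.
  have e1 := hδ (γ s₁) (γ s₂) (γ t) (u i)
  have e2 := hδ (u i) (γ s₂) (γ t) (u j)
  rw [gromovProduct_comm (u j)] at e2
  have hkδ : 0 ≤ k * δ := by positivity
  have hA := abs_nonneg A
  have e3 : D - |A| - k * δ ≤
      min (gromovProduct dist (u i) (u j) (γ t)) (gromovProduct dist (γ s₂) (u j) (γ t)) :=
    le_min hmid (by linarith)
  have e4 : D - |A| - k * δ - δ ≤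
      min (gromovProduct dist (γ s₁) (u i) (γ t)) (gromovProduct dist (u i) (γ s₂) (γ t)) :=
    le_min (by linarith) (by linarith)
  linarith

/-- The point of a geodesic from `x` to `y` at distance `(y|z)_x` from `x` is at distance about
`(x|y)_z` from `z`. -/
theorem exists_geodesic_dist_le {δ : ℝ}
    (hδ : ∀ x y z w : Y, min (gromovProduct dist x w z) (gromovProduct dist w y z) - δ ≤
      gromovProduct dist x y z)
    {x y : Y} {γ : ℝ → Y} (h0 : γ 0 = x) (h1 : γ (dist x y) = y)
    (hγ : ∀ s ∈ Set.Icc 0 (dist x y), ∀ t ∈ Set.Icc 0 (dist x y), dist (γ s) (γ t) = |s - t|)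
    (z : Y) :
    ∃ t ∈ Set.Icc 0 (dist x y), t = gromovProduct dist y z x ∧
      dist x (γ t) = t ∧ dist (γ t) y = dist x y - t ∧
      dist (γ t) z ≤ gromovProduct dist x y z + 2 * δ := by
  have ht : gromovProduct dist y z x ∈ Set.Icc 0 (dist x y) := by
    unfold gromovProduct
    rw [dist_comm y x, dist_comm z x]
    constructor
    · linarith [dist_triangle_left y z x]
    · linarith [dist_triangle x y z]
  have hL : 0 ≤ dist x y := dist_nonneg
  have hx : dist x (γ (gromovProduct dist y z x)) = gromovProduct dist y z x := by
    have h := hγ 0 ⟨le_rfl, hL⟩ _ ht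
    rwa [h0, zero_sub, abs_neg, abs_of_nonneg ht.1] at h
  have hy : dist (γ (gromovProduct dist y z x)) y = dist x y - gromovProduct dist y z x := by
    have h := hγ _ ht _ ⟨hL, le_rfl⟩
    rwa [h1, abs_of_nonpos (by linarith [ht.2]), neg_sub] at h
  refine ⟨_, ht, rfl, hx, hy, ?_⟩
  have key := hδ x y z (γ (gromovProduct dist y z x))
  set p := γ (gromovProduct dist y z x)
  -- The position of `p` is the one that makes the two products in `key` equal.
  have e : gromovProduct dist x p z = (gromovProduct dist x y z + dist p z) / 2 := by
    unfold gromovProduct at hx ⊢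
    rw [dist_comm y x, dist_comm z x] at hx
    linarith
  have e' : gromovProduct dist p y z = (gromovProduct dist x y z + dist p z) / 2 := by
    unfold gromovProduct at hy ⊢
    rw [dist_comm y x, dist_comm z x] at hy
    linarith
  rw [e, e', min_self] at key
  linarith

end Hyperbolic

/-! ### The metric graph -/

/-- The metric graph of a connected graph is hyperbolic if its vertex set is. -/
theorem gromovHyperbolic_metricGraph {V : Type*} {G : SimpleGraph V} (hG : G.Connected)
    (h : GromovHyperbolic fun v w : V => (G.dist v w : ℝ)) :
    GromovHyperbolic (MetricGraphPoint.dist : MetricGraphPoint G → _ → ℝ) := by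
  have htri : ∀ u v w : V, (G.dist u w : ℝ) ≤ G.dist u v + G.dist v w := fun u v w => by
    exact_mod_cast hG.dist_triangle
  have hedge : ∀ p : MetricGraphPoint G, (G.dist p.src p.tgt : ℝ) ≤ 1 := by
    intro p
    rcases p.edge with h | ⟨h, -⟩
    · rw [SimpleGraph.dist_eq_one_iff_adj.2 h]; simp
    · rw [h]; simp
  have hclose : ∀ p q : MetricGraphPoint G, |p.dist q - G.dist p.src q.src| ≤ 2 := by
    intro p q
    obtain ⟨hp0, hp1⟩ := p.pos_mem
    obtain ⟨hq0, hq1⟩ := q.pos_mem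
    have ep := hedge p
    have eq := hedge q
    have n1 : (0 : ℝ) ≤ G.dist p.src q.src := Nat.cast_nonneg _
    unfold MetricGraphPoint.dist
    split_ifs with h1 h2
    · rw [h1.1, SimpleGraph.dist_self, Nat.cast_zero, sub_zero, abs_abs, abs_le]
      constructor <;> linarith
    · rw [← h2.2] at n1 ⊢
      have h3 : |p.pos - (1 - q.pos)| ≤ 1 := by
        rw [abs_le]; constructor <;> linarith
      have h4 := abs_nonneg (p.pos - (1 - q.pos))
      rw [abs_le]
      constructor <;> linarith
    · rw [abs_le]
      constructor
      · rw [neg_le_sub_iff_le_add, ← sub_le_iff_le_add]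
        have t1 := htri p.src q.tgt q.src
        have t2 := htri p.src p.tgt q.src
        have t3 := htri p.tgt q.tgt q.src
        rw [SimpleGraph.dist_comm (u := q.tgt)] at t1 t3
        refine le_min (le_min ?_ ?_) (le_min ?_ ?_) <;> linarith
      · rw [sub_le_iff_le_add]
        refine (min_le_left _ _).trans ((min_le_left _ _).trans ?_)
        linarith
  obtain ⟨δ, hδ⟩ := h
  -- Three distances, each off by at most `2`, change a Gromov product by at most `3`; two products
  -- are compared.
  refine ⟨δ + 6, fun x y z w => ?_⟩
  have hprod : ∀ p q o : MetricGraphPoint G,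
      |gromovProduct MetricGraphPoint.dist p q o -
        gromovProduct (fun v w : V => (G.dist v w : ℝ)) p.src q.src o.src| ≤ 3 := by
    intro p q o
    have a := abs_le.1 (hclose p o)
    have b := abs_le.1 (hclose q o)
    have c := abs_le.1 (hclose p q)
    unfold gromovProduct
    rw [abs_le]
    constructor <;> linarith [a.1, a.2, b.1, b.2, c.1, c.2]
  have a := abs_le.1 (hprod x w z)
  have b := abs_le.1 (hprod w y z)
  have c := abs_le.1 (hprod x y z)
  have key := hδ x.src y.src z.src w.src
  rcases min_choice (gromovProduct (fun v w : V => (G.dist v w : ℝ)) x.src w.src z.src)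
    (gromovProduct (fun v w : V => (G.dist v w : ℝ)) w.src y.src z.src) with h | h
  · rw [h] at key
    have := min_le_left (gromovProduct MetricGraphPoint.dist x w z)
      (gromovProduct MetricGraphPoint.dist w y z)
    linarith [a.2, c.1]
  · rw [h] at key
    have := min_le_right (gromovProduct MetricGraphPoint.dist x w z)
      (gromovProduct MetricGraphPoint.dist w y z)
    linarith [b.2, c.1]

/-! ### Proximity graphs of cobounded maps -/

section Proximity

variable {V Y : Type*} [MetricSpace Y] {G : SimpleGraph V} {f : V → Y} {r : ℝ}

/-- The induction advances the point `p` rather than `f v`, so the error of approximating by orbit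
points does not accumulate. The extra edge leads from the last approximating vertex to `w`. -/
theorem exists_walk_of_dist_le (hY : IsGeodesicSpace Y) (hr : 0 < r)
    (hcob : ∀ p, ∃ v, dist p (f v) < r)
    (hG : ∀ v w, G.Adj v w ↔ v ≠ w ∧ dist (f v) (f w) ≤ 3 * r) (w : V) (n : ℕ) :
    ∀ (p : Y) (v : V), dist p (f v) < r → dist p (f w) ≤ n * r →
      ∃ W : G.Walk v w, W.length ≤ n + 1 := by
  have hstep : ∀ v v' : V, dist (f v) (f v') ≤ 3 * r → ∃ W : G.Walk v v', W.length ≤ 1 := by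
    intro v v' h
    by_cases hv : v = v'
    · subst hv; exact ⟨.nil, by simp⟩
    · exact ⟨.cons ((hG v v').2 ⟨hv, h⟩) .nil, by simp⟩
  induction n with
  | zero =>
    intro p v hv hw
    have hp : p = f w := dist_le_zero.1 (by simpa using hw)
    rw [hp, dist_comm] at hv
    simpa using hstep v w (by linarith)
  | succ n ih =>
    intro p v hv hw
    obtain ⟨γ, h0, h1, hγ⟩ := hY p (f w)
    have hd : 0 ≤ dist p (f w) := dist_nonneg
    have hs : min r (dist p (f w)) ∈ Set.Icc 0 (dist p (f w)) :=
      ⟨le_min hr.le hd, min_le_right _ _⟩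
    obtain ⟨v', hv'⟩ := hcob (γ (min r (dist p (f w))))
    have hp : dist p (γ (min r (dist p (f w)))) ≤ r := by
      have h := hγ 0 ⟨le_rfl, hd⟩ _ hs
      rw [h0, zero_sub, abs_neg, abs_of_nonneg hs.1] at h
      exact h.trans_le (min_le_left _ _)
    have hq : dist (γ (min r (dist p (f w)))) (f w) ≤ n * r := by
      have h := hγ _ hs _ ⟨hd, le_rfl⟩
      rw [h1, abs_of_nonpos (by linarith [hs.2])] at h
      rw [h]
      push_cast at hw
      have hn : 0 ≤ n * r := by positivity
      rcases min_choice r (dist p (f w)) with h | h <;> rw [h] <;> linarith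
    obtain ⟨W, hW⟩ := ih _ v' hv' hq
    obtain ⟨W', hW'⟩ := hstep v v' (by
      have := dist_triangle4 (f v) p (γ (min r (dist p (f w)))) (f v')
      rw [dist_comm (f v) p] at this
      linarith)
    exact ⟨W'.append W, by rw [SimpleGraph.Walk.length_append]; omega⟩

theorem connected_of_cobounded [Nonempty V] (hY : IsGeodesicSpace Y) (hr : 0 < r)
    (hcob : ∀ p, ∃ v, dist p (f v) < r)
    (hG : ∀ v w, G.Adj v w ↔ v ≠ w ∧ dist (f v) (f w) ≤ 3 * r) : G.Connected := by
  refine ⟨fun v w => ?_⟩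
  obtain ⟨n, hn⟩ := exists_nat_ge (dist (f v) (f w) / r)
  rw [div_le_iff₀ hr] at hn
  obtain ⟨W, -⟩ := exists_walk_of_dist_le hY hr hcob hG w n (f v) v (by simpa using hr) hn
  exact ⟨W⟩

/-- The `2` is one for rounding up `dist (f v) (f w) / r` and one for the extra edge of the walk. -/
theorem graphDist_le_of_cobounded (hY : IsGeodesicSpace Y) (hr : 0 < r)
    (hcob : ∀ p, ∃ v, dist p (f v) < r)
    (hG : ∀ v w, G.Adj v w ↔ v ≠ w ∧ dist (f v) (f w) ≤ 3 * r) (v w : V) :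
    (G.dist v w : ℝ) ≤ 1 / r * dist (f v) (f w) + 2 := by
  have hn := Nat.le_ceil (dist (f v) (f w) / r)
  have hn' := Nat.ceil_lt_add_one (div_nonneg (dist_nonneg (x := f v) (y := f w)) hr.le)
  rw [div_le_iff₀ hr] at hn
  obtain ⟨W, hW⟩ := exists_walk_of_dist_le hY hr hcob hG w _ (f v) v (by simpa using hr) hn
  have h : (G.dist v w : ℝ) ≤ (⌈dist (f v) (f w) / r⌉₊ : ℝ) + 1 := by
    exact_mod_cast (SimpleGraph.dist_le W).trans hW
  rw [one_div, inv_mul_eq_div]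
  linarith

/-- A vertex whose image has a bounded Gromov product with respect to the images of `x` and `y`
has a bounded Gromov product with respect to `x` and `y` in the proximity graph. -/
theorem exists_bound_gromovProduct_graph (hY : IsGeodesicSpace Y)
    (hyp : GromovHyperbolic (dist : Y → Y → ℝ)) (hr : 0 < r)
    (hcob : ∀ p, ∃ v, dist p (f v) < r)
    (hG : ∀ v w, G.Adj v w ↔ v ≠ w ∧ dist (f v) (f w) ≤ 3 * r) (hconn : G.Connected) (c : ℝ) :
    ∃ C : ℝ, ∀ x y v : V, gromovProduct dist (f x) (f y) (f v) ≤ c →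
      gromovProduct (fun v w : V => (G.dist v w : ℝ)) x y v ≤ C := by
  have htri : ∀ u v w : V, (G.dist u w : ℝ) ≤ G.dist u v + G.dist v w := fun u v w => by
    exact_mod_cast hconn.dist_triangle
  obtain ⟨C, hC⟩ := exists_forall_dist_quasiGeodesic_le hyp (3 * r) (1 / r) 2 (by positivity)
  obtain ⟨δ, hδ⟩ := hyp
  refine ⟨1 / r * (c + 2 * δ + C) + 2, fun x y v hv => ?_⟩
  obtain ⟨γ, h0, h1, hγ⟩ := hY (f x) (f y)
  obtain ⟨t, ht, -, -, -, htv⟩ := exists_geodesic_dist_le hδ h0 h1 hγ (f v)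
  obtain ⟨W, hW⟩ := hconn.exists_walk_length_eq_dist x y
  have hvert : ∀ i j, i ≤ j → j ≤ W.length →
      (j : ℝ) ≤ i + G.dist (W.getVert i) (W.getVert j) := by
    intro i j hij hj
    have a : G.dist x (W.getVert i) ≤ i := (SimpleGraph.dist_le (W.take i)).trans (by
      rw [SimpleGraph.Walk.take_length]; omega)
    have b : G.dist (W.getVert j) y ≤ W.length - j := (SimpleGraph.dist_le (W.drop j)).trans (by
      rw [SimpleGraph.Walk.drop_length])
    have c := hconn.dist_triangle (u := x) (v := W.getVert i) (w := y)
    have d := hconn.dist_triangle (u := W.getVert i) (v := W.getVert j) (w := y)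
    have : j ≤ i + G.dist (W.getVert i) (W.getVert j) := by omega
    exact_mod_cast this
  obtain ⟨i, hi, hid⟩ := hC W.length (fun i => f (W.getVert i)) γ _ dist_nonneg hγ
    (by simpa using h0) (by simpa using h1)
    (fun l hl => ((hG _ _).1 (W.adj_getVert_succ hl)).2)
    (fun i j hij hj => (hvert i j hij hj).trans (by
      have := graphDist_le_of_cobounded hY hr hcob hG (W.getVert i) (W.getVert j)
      linarith)) t ht
  -- `f v` and `f (W.getVert i)` are both near `γ t`, so `v` is close in the graph to a vertex of
  -- the graph geodesic, and that distance bounds the product.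
  have hd := graphDist_le_of_cobounded hY hr hcob hG (W.getVert i) v
  have hd' : dist (f (W.getVert i)) (f v) ≤ c + 2 * δ + C := by
    have := dist_triangle_left (f (W.getVert i)) (f v) (γ t)
    linarith
  have hd'' : 1 / r * dist (f (W.getVert i)) (f v) ≤ 1 / r * (c + 2 * δ + C) := by gcongr
  have hsum : (G.dist x (W.getVert i) : ℝ) + G.dist (W.getVert i) y ≤ G.dist x y := by
    have a : G.dist x (W.getVert i) ≤ i := (SimpleGraph.dist_le (W.take i)).trans (by
      rw [SimpleGraph.Walk.take_length]; omega)
    have b : G.dist (W.getVert i) y ≤ W.length - i := (SimpleGraph.dist_le (W.drop i)).trans (by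
      rw [SimpleGraph.Walk.drop_length])
    have : G.dist x (W.getVert i) + G.dist (W.getVert i) y ≤ G.dist x y := by omega
    exact_mod_cast this
  have t1 := htri x (W.getVert i) v
  have t2 := htri y (W.getVert i) v
  have t3 := htri x (W.getVert i) y
  rw [SimpleGraph.dist_comm (u := y) (v := W.getVert i)] at t2
  unfold gromovProduct
  linarith

/-- The proximity graph of a cobounded map to a geodesic hyperbolic space is hyperbolic. -/
theorem gromovHyperbolic_graphDist (hY : IsGeodesicSpace Y)
    (hyp : GromovHyperbolic (dist : Y → Y → ℝ)) (hr : 0 < r)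
    (hcob : ∀ p, ∃ v, dist p (f v) < r)
    (hG : ∀ v w, G.Adj v w ↔ v ≠ w ∧ dist (f v) (f w) ≤ 3 * r) (hconn : G.Connected) :
    GromovHyperbolic fun v w : V => (G.dist v w : ℝ) := by
  have htri : ∀ u v w : V, (G.dist u w : ℝ) ≤ G.dist u v + G.dist v w := fun u v w => by
    exact_mod_cast hconn.dist_triangle
  have hbound := exists_bound_gromovProduct_graph hY hyp hr hcob hG hconn
  obtain ⟨δ, hδ⟩ := hyp
  obtain ⟨C, hC⟩ := hbound (δ + r)
  -- With `v` near the center of the triangle, the product of `x` and `y` at `z` is at least `G.dist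
  -- v z - 2 * C`, while one of the other two is at most `G.dist v z + C`.
  refine ⟨3 * C, fun x y z w => ?_⟩
  obtain ⟨γ, h0, h1, hγ⟩ := hY (f x) (f y)
  obtain ⟨t, -, hteq, htx, hty, htz⟩ := exists_geodesic_dist_le hδ h0 h1 hγ (f z)
  obtain ⟨v, hv⟩ := hcob (γ t)
  have hxy : gromovProduct dist (f x) (f y) (f v) ≤ r := by
    refine (gromovProduct_le_add_dist _ _ _ (γ t)).trans ?_
    have : gromovProduct dist (f x) (f y) (γ t) = 0 := by
      unfold gromovProduct
      rw [dist_comm (f y), htx, hty]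
      ring
    linarith
  have hxz : gromovProduct dist (f x) (f z) (f v) ≤ δ + r := by
    refine (gromovProduct_le_add_dist _ _ _ (γ t)).trans ?_
    -- The products at `f x` and `f z` add up to `dist (f x) (f z)`, so passing through `γ t` costs
    -- at most `2 * δ`.
    have : gromovProduct dist (f x) (f z) (γ t) ≤ δ := by
      unfold gromovProduct at hteq htz ⊢
      rw [dist_comm (f y) (f x), dist_comm (f z) (f x)] at hteq
      rw [dist_comm (f z) (γ t)]
      linarith
    linarith
  have hyz : gromovProduct dist (f y) (f z) (f v) ≤ δ + r := by
    refine (gromovProduct_le_add_dist _ _ _ (γ t)).trans ?_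
    have : gromovProduct dist (f y) (f z) (γ t) ≤ δ := by
      unfold gromovProduct at hteq htz ⊢
      rw [dist_comm (f y) (f x), dist_comm (f z) (f x)] at hteq
      rw [dist_comm (f z) (γ t), dist_comm (f y) (γ t)]
      linarith
    linarith
  have gxz := hC x z v hxz
  have gyz := hC y z v hyz
  have lower : (G.dist v z : ℝ) - 2 * C ≤
      gromovProduct (fun v w : V => (G.dist v w : ℝ)) x y z := by
    have t3 := htri x v y
    simp only [gromovProduct] at gxz gyz ⊢
    rw [SimpleGraph.dist_comm (u := z) (v := v)] at gxz gyz
    rw [SimpleGraph.dist_comm (u := v) (v := y)] at t3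
    linarith
  have upper : ∀ a b : V, gromovProduct dist (f a) (f b) (f v) ≤ δ + r →
      gromovProduct (fun v w : V => (G.dist v w : ℝ)) a b z ≤ G.dist v z + C := by
    intro a b hab
    have h := hC a b v hab
    have t1 := htri a v z
    have t2 := htri b v z
    unfold gromovProduct at h ⊢
    linarith
  have key := hδ (f x) (f y) (f v) (f w)
  rcases min_choice (gromovProduct dist (f x) (f w) (f v))
    (gromovProduct dist (f w) (f y) (f v)) with h | h
  · rw [h] at key
    have h' := upper x w (by linarith)
    have := min_le_left (gromovProduct (fun v w : V => (G.dist v w : ℝ)) x w z)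
      (gromovProduct (fun v w : V => (G.dist v w : ℝ)) w y z)
    linarith
  · rw [h] at key
    have h' := upper w y (by linarith)
    have := min_le_right (gromovProduct (fun v w : V => (G.dist v w : ℝ)) x w z)
      (gromovProduct (fun v w : V => (G.dist v w : ℝ)) w y z)
    linarith

end Proximity

/-! ### The proximity relation of a section -/

section Action

variable {X H : Type*} [MeasurableSpace X] [MeasurableSpace H]

/-- The pairs of points of one fiber at distance at most `s` form a Borel set. -/
theorem MetricBundle.measurableSet_dist_le [StandardBorelSpace X] (B : MetricBundle X H) (s : ℝ) :
    MeasurableSet {p : H × H | ∃ h : B.proj p.1 = B.proj p.2,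
      dist (α := B.Fiber (B.proj p.2)) ⟨p.1, h⟩ ⟨p.2, rfl⟩ ≤ s} := by
  have hdiag : MeasurableSet {p : H × H | B.proj p.1 = B.proj p.2} := by
    let := upgradeStandardBorel X
    exact measurableSet_eq_fun (B.measurable_proj.comp measurable_fst)
      (B.measurable_proj.comp measurable_snd)
  have h := hdiag.subtype_image (B.measurable_dist measurableSet_Iic : MeasurableSet
    ((fun p : {p : H × H // B.proj p.1 = B.proj p.2} =>
      (B.metric (B.proj p.1.1)).dist ⟨p.1.1, rfl⟩ ⟨p.1.2, p.2.symm⟩) ⁻¹' Set.Iic s))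
  have aux : ∀ (x : X) (p q : H) (hp : B.proj p = x) (hq : B.proj q = x),
      (B.metric x).dist ⟨p, hp⟩ ⟨q, hq⟩ =
        dist (α := B.Fiber (B.proj q)) ⟨p, hp.trans hq.symm⟩ ⟨q, rfl⟩ := by
    rintro x p q hp rfl
    rfl
  convert h using 1
  ext ⟨p, q⟩
  constructor
  · rintro ⟨e, hle⟩
    exact ⟨⟨(p, q), e⟩, (aux _ p q rfl e.symm).trans_le hle, rfl⟩
  · rintro ⟨⟨_, e⟩, hle, rfl⟩
    exact ⟨e, (aux _ p q rfl e.symm).symm.trans_le hle⟩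

namespace IsometricAction

variable {R : Setoid X} {B : MetricBundle X H} (α : IsometricAction R B) (σ : BorelSection B)

theorem map_refl (x : X) (p : B.Fiber x) : α.map (R.refl x) p = p :=
  (α.map (R.refl x)).injective (α.cocycle _ _ p)

/-- Lets all pairs of one class be compared in a single fiber. -/
theorem mem_proximityGraph_iff {s : ℝ} {x y z : X} (hx : R z x) (hy : R z y) :
    (x, y) ∈ α.proximityGraph σ s ↔
      dist (α.orbitMap σ z ⟨x, hx⟩) (α.orbitMap σ z ⟨y, hy⟩) ≤ s :=
  ⟨fun ⟨h, hle⟩ => (α.dSigma_eq σ h hx hy).symm.trans_le hle,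
    fun hle => ⟨R.trans (R.symm hx) hy, (α.dSigma_eq σ _ hx hy).trans_le hle⟩⟩

/-- The proximity relation is Borel: it is the injective image of the Borel set of the triples
`(x, y, α(x,y)σ(y))` in it. -/
theorem measurableSet_proximityGraph [StandardBorelSpace X] [StandardBorelSpace H] (s : ℝ) :
    MeasurableSet (α.proximityGraph σ s) := by
  have hgraph : ∀ (y : X) (p : H), ((p, σ.toFun y) ∈ {pq : H × H |
      ∃ h : R (B.proj pq.1) (B.proj pq.2),
        α.map h ⟨pq.2, rfl⟩ = (⟨pq.1, rfl⟩ : B.Fiber (B.proj pq.1))}) ↔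
      ∃ h : R (B.proj p) y, (α.orbitMap σ (B.proj p) ⟨y, h⟩).1 = p := by
    intro y p
    -- The base point of `σ.toFun y` equals `y` only propositionally; generalizing it permits
    -- substitution.
    have aux : ∀ (y' : X) (q : H) (e : B.proj q = y'),
        (∃ h : R (B.proj p) (B.proj q), α.map h ⟨q, rfl⟩ = (⟨p, rfl⟩ : B.Fiber (B.proj p))) ↔
          ∃ h : R (B.proj p) y', (α.map h ⟨q, e⟩).1 = p := by
      rintro _ q rfl
      exact exists_congr fun h => Subtype.ext_iff
    exact aux y _ (σ.proj_toFun y)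
  let T : Set ((X × X) × H) := {q | B.proj q.2 = q.1.1 ∧
    (q.2, σ.toFun q.1.2) ∈ {pq : H × H | ∃ h : R (B.proj pq.1) (B.proj pq.2),
      α.map h ⟨pq.2, rfl⟩ = (⟨pq.1, rfl⟩ : B.Fiber (B.proj pq.1))} ∧
    (σ.toFun q.1.1, q.2) ∈ {p : H × H | ∃ h : B.proj p.1 = B.proj p.2,
      dist (α := B.Fiber (B.proj p.2)) ⟨p.1, h⟩ ⟨p.2, rfl⟩ ≤ s}}
  have hT : MeasurableSet T := by
    refine MeasurableSet.inter ?_ (MeasurableSet.inter ?_ ?_)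
    · let := upgradeStandardBorel X
      exact measurableSet_eq_fun (B.measurable_proj.comp measurable_snd)
        (measurable_fst.comp measurable_fst)
    · exact (measurable_snd.prodMk (σ.measurable_toFun.comp
        (measurable_snd.comp measurable_fst))) α.borel
    · exact ((σ.measurable_toFun.comp (measurable_fst.comp measurable_fst)).prodMk
        measurable_snd) (B.measurableSet_dist_le s)
  have hinj : Set.InjOn Prod.fst T := by
    rintro ⟨⟨x, y⟩, p⟩ ⟨hp, hpg, -⟩ ⟨⟨x', y'⟩, p'⟩ ⟨hp', hpg', -⟩ he
    obtain ⟨rfl, rfl⟩ := Prod.mk.inj he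
    obtain ⟨h, e⟩ := (hgraph y p).1 hpg
    obtain ⟨h', e'⟩ := (hgraph y p').1 hpg'
    simp only at hp hp'
    have : p = p' := by
      rw [← e, ← e']
      generalize_proofs at *
      clear e e' hpg hpg'
      revert h h'
      rw [hp, hp']
      intros
      rfl
    rw [this]
  have himage : α.proximityGraph σ s = Prod.fst '' T := by
    ext ⟨x, y⟩
    constructor
    · rintro ⟨h, hle⟩
      refine ⟨((x, y), (α.orbitMap σ x ⟨y, h⟩).1), ⟨(α.orbitMap σ x ⟨y, h⟩).2, ?_, ?_⟩, rfl⟩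
      · rw [hgraph]
        have hp : B.proj (α.orbitMap σ x ⟨y, h⟩).1 = x := (α.orbitMap σ x ⟨y, h⟩).2
        have aux : ∀ (x' : X) (e : x' = x) (h' : R x' y),
            (α.orbitMap σ x' ⟨y, h'⟩).1 = (α.orbitMap σ x ⟨y, h⟩).1 := by
          rintro _ rfl _
          rfl
        exact ⟨(congrArg (R · y) hp).mpr h, aux _ hp _⟩
      · have aux : ∀ (x' : X) (p q : B.Fiber x'), dist p q ≤ s →
            ∃ e : B.proj p.1 = B.proj q.1,
              dist (α := B.Fiber (B.proj q.1)) ⟨p.1, e⟩ ⟨q.1, rfl⟩ ≤ s := by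
          rintro x' ⟨p, hp⟩ ⟨q, rfl⟩ hpq
          exact ⟨hp, hpq⟩
        refine aux x (σ.val x) _ ?_
        unfold dSigma at hle
        simpa only [orbitMap, α.map_refl] using hle
    · rintro ⟨⟨⟨x, y⟩, p⟩, ⟨hp, hpg, e, hle⟩, he⟩
      obtain ⟨rfl, rfl⟩ := Prod.mk.inj he
      simp only at hp
      subst hp
      obtain ⟨h, e'⟩ := (hgraph y p).1 hpg
      refine ⟨h, ?_⟩
      unfold dSigma
      have e2 : α.orbitMap σ (B.proj p) ⟨y, h⟩ = ⟨p, rfl⟩ := Subtype.ext e'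
      have e3 : α.orbitMap σ (B.proj p) ⟨B.proj p, R.refl _⟩ = ⟨σ.toFun (B.proj p), e⟩ :=
        α.map_refl _ _
      rw [e2, e3]
      exact hle
  rw [himage]
  -- Lusin–Souslin: an injective Borel image of a Borel set is Borel.
  exact hT.image_of_measurable_injOn measurable_fst hinj

theorem graphAt_proximityGraph_adj (s : ℝ) (x : X) (v w : EqClass R x) :
    (graphAt R (α.proximityGraph σ s) x).Adj v w ↔
      v ≠ w ∧ dist (α.orbitMap σ x v) (α.orbitMap σ x w) ≤ s := by
  rw [graphAt, SimpleGraph.fromRel_adj, α.mem_proximityGraph_iff σ v.2 w.2,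
    α.mem_proximityGraph_iff σ w.2 v.2, dist_comm (α.orbitMap σ x w), or_self]

theorem connected_graphAt_proximityGraph (hB : B.IsHyperbolic) {r : ℝ} (hr : 0 < r)
    (hcob : α.Cobounded σ r) (x : X) :
    (graphAt R (α.proximityGraph σ (3 * r)) x).Connected :=
  haveI : Nonempty (EqClass R x) := ⟨⟨x, R.refl x⟩⟩
  connected_of_cobounded (hB x).1 hr (hcob x) (α.graphAt_proximityGraph_adj σ (3 * r) x)

theorem isGraphing_proximityGraph [StandardBorelSpace X] [StandardBorelSpace H]
    (hB : B.IsHyperbolic) {r : ℝ} (hr : 0 < r) (hcob : α.Cobounded σ r) :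
    IsGraphing R (α.proximityGraph σ (3 * r)) where
  measurableSet := α.measurableSet_proximityGraph σ _
  symm x y := by
    rintro ⟨h, hle⟩
    rw [α.mem_proximityGraph_iff σ h (R.refl x), dist_comm]
    exact hle
  generates := by
    -- Minimality is connectivity: `S` contains the edges, hence relates the ends of every walk.
    refine ⟨fun x y h => h.1, fun S hS x y hxy => ?_⟩
    obtain ⟨W⟩ := (α.connected_graphAt_proximityGraph σ hB hr hcob x).preconnected
      ⟨x, R.refl x⟩ ⟨y, hxy⟩
    have hwalk : ∀ v w : EqClass R x,
        (graphAt R (α.proximityGraph σ (3 * r)) x).Walk v w → S v.1 w.1 := by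
      intro v w W
      induction W with
      | nil => exact S.refl _
      | @cons u v w hadj _ ih =>
        refine S.trans (hS u.1 v.1 ?_) ih
        rw [α.mem_proximityGraph_iff σ u.2 v.2]
        exact ((α.graphAt_proximityGraph_adj σ _ x u v).1 hadj).2
    exact hwalk _ _ W

theorem isLocallyFinite_proximityGraph (hproper : α.MetricallyProper σ) (hfin : α.FiniteToOne σ)
    (s : ℝ) : IsLocallyFinite (α.proximityGraph σ s) := by
  intro x
  -- Balls are open, so the radius `s + 1` captures distances up to `s`.
  have h1 := hproper x (α.orbitMap σ x ⟨x, R.refl x⟩) (s + 1)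
  have h2 := h1.preimage' (f := α.orbitMap σ x) fun p _ => hfin x p
  refine (h2.image Subtype.val).subset ?_
  rintro y ⟨h, hle⟩
  refine ⟨⟨y, h⟩, ⟨⟨_, rfl⟩, ?_⟩, rfl⟩
  rw [Metric.mem_ball, dist_comm]
  exact lt_of_le_of_lt hle (lt_add_one s)

end IsometricAction

end Action

end HypBundle

theorem mainTheorem9 {X H : Type*} [MeasurableSpace X] [StandardBorelSpace X]
    [MeasurableSpace H] [StandardBorelSpace H]
    (R : Setoid X) (hR : HypBundle.IsDiscreteBorel R)
    (B : HypBundle.MetricBundle X H) (hB : B.IsHyperbolic)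
    (α : HypBundle.IsometricAction R B) (σ : HypBundle.BorelSection B)
    (hproper : α.MetricallyProper σ)
    (r : ℝ) (hr : 0 < r) (hcob : α.Cobounded σ r) :
    HypBundle.IsHyperbolicGraphing R (α.proximityGraph σ (3 * r)) ∧
      (α.FiniteToOne σ → HypBundle.IsLocallyFinite (α.proximityGraph σ (3 * r))) := by
  exact ⟨⟨α.isGraphing_proximityGraph σ hB hr hcob, fun x =>
    HypBundle.gromovHyperbolic_metricGraph
      (α.connected_graphAt_proximityGraph σ hB hr hcob x)
      (HypBundle.gromovHyperbolic_graphDist (hB x).1 (hB x).2 hr (hcob x)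
        (α.graphAt_proximityGraph_adj σ (3 * r) x)
        (α.connected_graphAt_proximityGraph σ hB hr hcob x))⟩,
    fun hfin => α.isLocallyFinite_proximityGraph σ hproper hfin (3 * r)⟩
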